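/- Let $V=\{V_n\}_{n\in\mathbb Z}\in\ell^\infty(\mathbb Z)$ be a bounded sequence of real numbers, and let $H=-\Delta+V$ be the discrete Schrödinger operator on $\ell^2(\mathbb Z^2)$ (complex-valued square-summable sequences $\psi=\{\psi_{n,m}\}$) given by $$(H\psi)_{n,m}=-(\psi_{n+1,m}+\psi_{n-1,m}+\psi_{n,m+1}+\psi_{n,m-1})+V_n\psi_{n,m},\qquad (n,m)\in\mathbb Z^2,$$ so that the potential is independent of $m$. Then $H$ is a bounded self-adjoint operator with purely absolutely continuous spectrum: for every $\psi\in\ell^2(\mathbb Z^2)$ the spectral measure $\mu_\psi$ of $H$ at $\psi$, that is, the finite Borel measure on $\mathbb R$ with $\int f\,d\mu_\psi=\langle \psi, f(H)\psi\rangle$ for all continuous compactly supported $f:\mathbb R\to\mathbb R$ (equivalently $\mu_\psi(B)=\langle P(B)\psi,\psi\rangle$ with $P$ the projection-valued measure of $H$), is absolutely continuous with respect to Lebesgue measure. -/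

import Mathlib

open MeasureTheory CompactlySupported
open scoped ENNReal

noncomputable section

section SpectralMeasure

variable {E : Type*} [NormedAddCommGroup E] [InnerProductSpace ℂ E] [CompleteSpace E]

/-- For a bounded self-adjoint operator `T` and a vector `ψ`, the positive linear functional
`f ↦ ⟨ψ, f(T) ψ⟩` on compactly supported continuous functions `f : ℝ → ℝ`, where `f(T)` is given by
the continuous functional calculus. (The number `⟨ψ, f(T) ψ⟩` is real, as `f(T)` is
self-adjoint.) -/
def spectralFunctional (T : E →L[ℂ] E) (_hT : IsSelfAdjoint T) (ψ : E) :
    C_c(ℝ, ℝ) →ₚ[ℝ] ℝ :=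
  PositiveLinearMap.mk₀
    { toFun := fun f => (inner ℂ ψ (cfc (f : ℝ → ℝ) T ψ)).re
      map_add' := fun f g => by
        have h : cfc (⇑(f + g)) T = cfc (⇑f) T + cfc (⇑g) T :=
          cfc_add T (⇑f) (⇑g) f.continuous.continuousOn g.continuous.continuousOn
        rw [h, add_apply, inner_add_right, Complex.add_re]
      map_smul' := fun c f => by
        have h : cfc (⇑(c • f)) T = c • cfc (⇑f) T :=
          cfc_smul c (⇑f) T f.continuous.continuousOn
        rw [h, smul_apply, ← Complex.coe_smul, inner_smul_right]
        simp }
    (fun f hf => by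
      have h : 0 ≤ cfc (⇑f) T := cfc_nonneg fun x _ => hf x
      have h' := (ContinuousLinearMap.nonneg_iff_isPositive _).1 h
      exact (Complex.le_def.1 (h'.inner_nonneg_right ψ)).1)

/-- The spectral measure of the bounded self-adjoint operator `T` at the vector `ψ`: the Borel
measure `μ` on `ℝ` with `∫ f dμ = ⟨ψ, f(T) ψ⟩`, obtained from the Riesz–Markov–Kakutani theorem.
In terms of the projection-valued measure `P` of `T` it is `B ↦ ⟨P(B) ψ, ψ⟩`. -/
def spectralMeasure (T : E →L[ℂ] E) (hT : IsSelfAdjoint T) (ψ : E) : Measure ℝ :=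
  RealRMK.rieszMeasure (spectralFunctional T hT ψ)

/-- The defining property of the spectral measure. -/
theorem integral_spectralMeasure (T : E →L[ℂ] E) (hT : IsSelfAdjoint T) (ψ : E) (f : C_c(ℝ, ℝ)) :
    ∫ x, f x ∂(spectralMeasure T hT ψ) = (inner ℂ ψ (cfc (f : ℝ → ℝ) T ψ)).re :=
  RealRMK.integral_rieszMeasure (spectralFunctional T hT ψ) f

/-- A bounded operator has purely absolutely continuous spectrum if it is self-adjoint and all its
spectral measures are absolutely continuous with respect to Lebesgue measure. -/
def HasPurelyACSpectrum (T : E →L[ℂ] E) : Prop :=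
  ∃ hT : IsSelfAdjoint T, ∀ ψ : E, spectralMeasure T hT ψ ≪ (volume : Measure ℝ)

end SpectralMeasure

section Operator

theorem memℓp_two_comp_equiv {ι : Type*} (e : ι ≃ ι) {f : ι → ℂ} (hf : Memℓp f 2) :
    Memℓp (fun i => f (e i)) 2 := by
  have h2 : 0 < (2 : ℝ≥0∞).toReal := by norm_num
  rw [memℓp_gen_iff h2] at hf ⊢
  exact e.summable_iff.2 hf

theorem memℓp_two_shift {f : ℤ × ℤ → ℂ} (hf : Memℓp f 2) (a : ℤ × ℤ) :
    Memℓp (fun p => f (p + a)) 2 :=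
  memℓp_two_comp_equiv (Equiv.addRight a) hf

theorem memℓp_two_potential (V : lp (fun _ : ℤ => ℝ) ∞) {f : ℤ × ℤ → ℂ} (hf : Memℓp f 2) :
    Memℓp (fun p : ℤ × ℤ => (V p.1 : ℂ) * f p) 2 := by
  refine (hf.const_smul (‖V‖ : ℂ)).mono' fun p => ?_
  have h := lp.norm_apply_le_norm ENNReal.top_ne_zero V p.1
  simp only [Pi.smul_apply, smul_eq_mul, norm_mul, Complex.norm_real, norm_norm]
  gcongr

theorem memℓp_two_schrodinger (V : lp (fun _ : ℤ => ℝ) ∞) {f : ℤ × ℤ → ℂ} (hf : Memℓp f 2) :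
    Memℓp (fun p : ℤ × ℤ => -(f (p.1 + 1, p.2) + f (p.1 - 1, p.2) + f (p.1, p.2 + 1)
      + f (p.1, p.2 - 1)) + (V p.1 : ℂ) * f p) 2 := by
  have h := ((((memℓp_two_shift hf (1, 0)).add (memℓp_two_shift hf (-1, 0))).add
    (memℓp_two_shift hf (0, 1))).add (memℓp_two_shift hf (0, -1))).neg.add
    (memℓp_two_potential V hf)
  convert h using 1
  funext p
  simp [Prod.add_def, sub_eq_add_neg]

/-- The discrete Schrödinger operator `-Δ + V` on `ℓ²(ℤ²)` as a linear map:
`(Hψ)(n, m) = -(ψ(n+1, m) + ψ(n-1, m) + ψ(n, m+1) + ψ(n, m-1)) + V(n) ψ(n, m)`. -/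
def schrodingerLinear (V : lp (fun _ : ℤ => ℝ) ∞) :
    lp (fun _ : ℤ × ℤ => ℂ) 2 →ₗ[ℂ] lp (fun _ : ℤ × ℤ => ℂ) 2 where
  toFun ψ := ⟨fun p => -(ψ (p.1 + 1, p.2) + ψ (p.1 - 1, p.2) + ψ (p.1, p.2 + 1)
      + ψ (p.1, p.2 - 1)) + (V p.1 : ℂ) * ψ p,
    memℓp_two_schrodinger V ψ.2⟩
  map_add' ψ φ := by
    ext p
    simp only [lp.coeFn_add, Pi.add_apply]
    ring
  map_smul' c ψ := by
    ext p
    simp only [lp.coeFn_smul, Pi.smul_apply, smul_eq_mul, RingHom.id_apply]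
    ring

theorem schrodingerLinear_apply (V : lp (fun _ : ℤ => ℝ) ∞)
    (ψ : lp (fun _ : ℤ × ℤ => ℂ) 2) (p : ℤ × ℤ) :
    schrodingerLinear V ψ p = -(ψ (p.1 + 1, p.2) + ψ (p.1 - 1, p.2) + ψ (p.1, p.2 + 1)
      + ψ (p.1, p.2 - 1)) + (V p.1 : ℂ) * ψ p := rfl

theorem continuous_schrodingerLinear (V : lp (fun _ : ℤ => ℝ) ∞) :
    Continuous (schrodingerLinear V) := by
  refine (schrodingerLinear V).continuous_of_seq_closed_graph fun u x y hu hy => ?_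
  have ev : ∀ p : ℤ × ℤ, Continuous fun φ : lp (fun _ : ℤ × ℤ => ℂ) 2 => φ p := fun p =>
    (lp.evalCLM ℂ (fun _ : ℤ × ℤ => ℂ) 2 p).continuous
  ext p
  have h1 := ((ev p).tendsto y).comp hy
  have h2 : Continuous fun φ : lp (fun _ : ℤ × ℤ => ℂ) 2 => schrodingerLinear V φ p := by
    simp only [schrodingerLinear_apply]
    exact (((((ev _).add (ev _)).add (ev _)).add (ev _)).neg).add (continuous_const.mul (ev _))
  exact tendsto_nhds_unique h1 ((h2.tendsto x).comp hu)

/-- The discrete Schrödinger operator `-Δ + V` as a bounded operator on `ℓ²(ℤ²)`; the potential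
`V ∈ ℓ^∞(ℤ)` is real and depends on the first coordinate only. -/
def schrodinger (V : lp (fun _ : ℤ => ℝ) ∞) :
    lp (fun _ : ℤ × ℤ => ℂ) 2 →L[ℂ] lp (fun _ : ℤ × ℤ => ℂ) 2 :=
  ⟨schrodingerLinear V, continuous_schrodingerLinear V⟩

end Operator

end

/-!
Write `-Δ + V = K + (U + U⋆)`, where `K` acts in the first variable only and `U` is minus the
translation in the second variable, a unitary commuting with `K`. If `ψ` lives on a single row,
then so does every `K ^ a ψ`, so `ψ` is orthogonal to `K ^ a U ^ n ψ` for all `n ≥ 1`. For the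
rescaled Chebyshev polynomials, `C_n (U + U⋆) = U ^ n + U⋆ ^ n`, while for `n ≥ 1` the integral of
`C_n` against the arcsine law on `[-2, 2]` vanishes. Since the `C_n` span all polynomials, comparing
moments shows that the spectral measure of `-Δ + V` at `ψ` is the convolution of the spectral
measure of `K` at `ψ` with the arcsine law. As the arcsine law has a density, so does the
convolution. The vectors with absolutely continuous spectral measure form a closed subspace, which
contains all `ψ` supported at one point, hence is everything.
-/

open Polynomial.Chebyshev
open scoped lp Pointwise Polynomial

section Moments

theorem integrable_of_ae_mem_isCompact {μ : Measure ℝ} [IsFiniteMeasureOnCompacts μ] {K : Set ℝ}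
    (hK : IsCompact K) (hμ : ∀ᵐ x ∂μ, x ∈ K) {f : ℝ → ℝ} (hf : Continuous f) :
    Integrable f μ := by
  rw [← Measure.restrict_eq_self_of_ae_mem hμ]
  exact hf.continuousOn.integrableOn_compact hK

theorem integral_eval_eq_of_moments {μ ν : Measure ℝ}
    (hμ : ∀ k : ℕ, Integrable (fun x => x ^ k) μ) (hν : ∀ k : ℕ, Integrable (fun x => x ^ k) ν)
    (h : ∀ k : ℕ, ∫ x, x ^ k ∂μ = ∫ x, x ^ k ∂ν) (p : ℝ[X]) :
    ∫ x, p.eval x ∂μ = ∫ x, p.eval x ∂ν := by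
  simp only [Polynomial.eval_eq_sum_range]
  rw [integral_finsetSum _ fun k _ => (hμ k).const_mul _,
    integral_finsetSum _ fun k _ => (hν k).const_mul _]
  simp only [integral_const_mul, h]

theorem abs_integral_sub_le_of_ae {X : Type*} [MeasurableSpace X] {μ : Measure X}
    [IsFiniteMeasure μ] {f g : X → ℝ} (hf : Integrable f μ) (hg : Integrable g μ) {δ : ℝ}
    (h : ∀ᵐ x ∂μ, |f x - g x| ≤ δ) : |∫ x, f x ∂μ - ∫ x, g x ∂μ| ≤ δ * μ.real Set.univ := by
  rw [← integral_sub hf hg, ← Real.norm_eq_abs]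
  exact norm_integral_le_of_norm_le_const h

theorem measure_ext_of_moments {μ ν : Measure ℝ} [IsFiniteMeasure μ] [IsFiniteMeasure ν]
    {K L : Set ℝ} (hK : IsCompact K) (hL : IsCompact L)
    (hμ : ∀ᵐ x ∂μ, x ∈ K) (hν : ∀ᵐ x ∂ν, x ∈ L)
    (h : ∀ k : ℕ, ∫ x, x ^ k ∂μ = ∫ x, x ^ k ∂ν) : μ = ν := by
  have hμi {f : ℝ → ℝ} (hf : Continuous f) : Integrable f μ :=
    integrable_of_ae_mem_isCompact hK hμ hf
  have hνi {f : ℝ → ℝ} (hf : Continuous f) : Integrable f ν :=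
    integrable_of_ae_mem_isCompact hL hν hf
  obtain ⟨a, b, hab⟩ : ∃ a b, K ∪ L ⊆ Set.Icc a b :=
    bddBelow_bddAbove_iff_subset_Icc.1 ⟨(hK.union hL).bddBelow, (hK.union hL).bddAbove⟩
  refine Measure.ext_of_integral_eq_on_compactlySupported fun f =>
    eq_of_abs_sub_le_all fun ε hε => ?_
  set M := μ.real Set.univ + ν.real Set.univ + 1
  have hM : 0 < M := by positivity
  obtain ⟨p, hp⟩ := exists_polynomial_near_of_continuousOn a b f f.continuous.continuousOn
    (ε / M) (by positivity)
  have hpμ : |∫ x, p.eval x ∂μ - ∫ x, f x ∂μ| ≤ ε / M * μ.real Set.univ :=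
    abs_integral_sub_le_of_ae (hμi p.continuous) f.integrable
      (hμ.mono fun x hx => (hp x (hab (.inl hx))).le)
  have hpν : |∫ x, p.eval x ∂ν - ∫ x, f x ∂ν| ≤ ε / M * ν.real Set.univ :=
    abs_integral_sub_le_of_ae (hνi p.continuous) f.integrable
      (hν.mono fun x hx => (hp x (hab (.inr hx))).le)
  rw [integral_eval_eq_of_moments (fun k => hμi (continuous_pow k))
    (fun k => hνi (continuous_pow k)) h, abs_sub_comm] at hpμ
  calc |∫ x, f x ∂μ - ∫ x, f x ∂ν|
      ≤ |∫ x, f x ∂μ - ∫ x, p.eval x ∂ν| + |∫ x, p.eval x ∂ν - ∫ x, f x ∂ν| := abs_sub_le _ _ _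
    _ ≤ ε / M * (M - 1) := by linarith
    _ ≤ ε / M * M := by gcongr; linarith
    _ = ε := div_mul_cancel₀ ε hM.ne'

theorem integral_pow_conv {μ ν : Measure ℝ} [SFinite μ] [SFinite ν]
    (hμ : ∀ k : ℕ, Integrable (fun x => x ^ k) μ) (hν : ∀ k : ℕ, Integrable (fun x => x ^ k) ν)
    (n : ℕ) :
    ∫ x, x ^ n ∂(μ.conv ν) = ∑ m ∈ Finset.range (n + 1),
      (∫ x, x ^ m ∂μ) * (∫ x, x ^ (n - m) ∂ν) * n.choose m := by
  rw [Measure.conv, integral_map (by fun_prop) (by fun_prop)]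
  simp only [add_pow]
  rw [integral_finsetSum _ fun m _ => ((hμ m).mul_prod (hν (n - m))).mul_const _]
  refine Finset.sum_congr rfl fun m _ => ?_
  rw [integral_mul_const, integral_prod_mul (fun x : ℝ => x ^ m) (fun x : ℝ => x ^ (n - m))]

theorem ae_conv_mem_add {μ ν : Measure ℝ} {K L : Set ℝ}
    (hKL : MeasurableSet (K + L)) (hμ : ∀ᵐ x ∂μ, x ∈ K) (hν : ∀ᵐ x ∂ν, x ∈ L) :
    ∀ᵐ z ∂(μ.conv ν), z ∈ K + L := by
  refine (ae_map_iff (by fun_prop) hKL).2 ?_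
  filter_upwards [Measure.quasiMeasurePreserving_fst.ae hμ,
    Measure.quasiMeasurePreserving_snd.ae hν] with z hz₁ hz₂
  exact Set.add_mem_add hz₁ hz₂

end Moments

section ChebyshevBasis

theorem X_pow_mul_chebyshev_C_mem_span (R : Type*) [CommRing R] (b : ℕ) (n : ℤ) :
    Polynomial.X ^ b * C R n ∈ Submodule.span R (Set.range fun n : ℕ => C R n) := by
  induction b generalizing n with
  | zero =>
    rw [pow_zero, one_mul, ← C_natAbs]
    exact Submodule.subset_span ⟨_, rfl⟩
  | succ b ih =>
    have hrec : Polynomial.X ^ (b + 1) * C R n =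
        Polynomial.X ^ b * C R (n + 1) + Polynomial.X ^ b * C R (n - 1) := by
      rw [C_add_one]; ring
    rw [hrec]
    exact add_mem (ih _) (ih _)

theorem span_range_chebyshev_C_eq_top (R : Type*) [CommRing R] [Invertible (2 : R)] :
    Submodule.span R (Set.range fun n : ℕ => C R n) = ⊤ := by
  refine eq_top_iff.2 fun p _ => ?_
  induction p using Polynomial.induction_on' with
  | add p q hp hq => exact add_mem (hp trivial) (hq trivial)
  | monomial b r =>
    have hr : Polynomial.C r = Polynomial.C (r * ⅟2) * 2 := by
      rw [← map_ofNat Polynomial.C 2, ← Polynomial.C_mul, mul_assoc, invOf_mul_self, mul_one]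
    have h : Polynomial.monomial b r = (r * ⅟2) • (Polynomial.X ^ b * C R 0) := by
      rw [← Polynomial.C_mul_X_pow_eq_monomial, C_zero, Polynomial.smul_eq_C_mul, hr]
      ring
    rw [h]
    exact Submodule.smul_mem _ _ (X_pow_mul_chebyshev_C_mem_span R b 0)

theorem aeval_add_chebyshev_C_of_mul_eq_one {R A : Type*} [CommRing R] [Ring A] [Algebra R A]
    {x y : A} (hxy : x * y = 1) (hyx : y * x = 1) (n : ℕ) :
    Polynomial.aeval (x + y) (C R n) = x ^ n + y ^ n := by
  induction n using Nat.twoStepInduction with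
  | zero =>
    simp only [Nat.cast_zero, C_zero, map_ofNat, pow_zero]
    exact one_add_one_eq_two.symm
  | one => simp
  | more n ih₀ ih₁ =>
    push_cast at ih₁ ⊢
    rw [C_add_two, map_sub, map_mul, Polynomial.aeval_X, ih₀, ih₁, add_mul, mul_add, mul_add,
      pow_succ' y n, ← mul_assoc x, hxy, pow_succ' x n, ← mul_assoc y, hyx]
    simp only [one_mul, pow_succ']
    abel

end ChebyshevBasis

section ArcsineLaw

/-- The arcsine law on `[-2, 2]`, i.e. the law of `2 cos θ` for a uniform angle `θ`. It is the
spectral measure of `U + U⋆` at a unit vector `ψ` for which the `U ^ n ψ` are orthonormal. -/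
noncomputable def arcsineLaw : Measure ℝ :=
  ENNReal.ofReal Real.pi⁻¹ • measureT.map (2 * ·)

theorem measureT_absolutelyContinuous : measureT ≪ volume :=
  Measure.restrict_le_self.absolutelyContinuous.trans (withDensity_absolutelyContinuous _ _)

theorem arcsineLaw_absolutelyContinuous : arcsineLaw ≪ volume := by
  have h : volume.map (2 * · : ℝ → ℝ) ≪ volume := by
    rw [Real.map_volume_mul_left two_ne_zero]
    exact Measure.smul_absolutelyContinuous
  exact Measure.smul_absolutelyContinuous.trans
    ((measureT_absolutelyContinuous.map (by fun_prop)).trans h)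

instance isFiniteMeasure_arcsineLaw : IsFiniteMeasure arcsineLaw :=
  have : IsFiniteMeasure measureT :=
    (integrable_const_iff_isFiniteMeasure one_ne_zero).1
      (integrable_measureT (f := fun _ => (1 : ℝ)) continuousOn_const)
  Measure.smul_finite _ ENNReal.ofReal_ne_top

theorem ae_arcsineLaw_mem_Icc : ∀ᵐ x ∂arcsineLaw, x ∈ Set.Icc (-2) 2 := by
  refine Measure.ae_smul_measure ((ae_map_iff (by fun_prop) measurableSet_Icc).2 ?_) _
  filter_upwards [ae_restrict_mem measurableSet_Ioc] with x hx
  constructor <;> linarith [hx.1, hx.2]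

theorem integrable_arcsineLaw {f : ℝ → ℝ} (hf : Continuous f) : Integrable f arcsineLaw :=
  integrable_of_ae_mem_isCompact isCompact_Icc ae_arcsineLaw_mem_Icc hf

theorem integral_chebyshev_C_arcsineLaw (n : ℤ) :
    ∫ x, (C ℝ n).eval x ∂arcsineLaw = if n = 0 then 2 else 0 := by
  have hC (x : ℝ) : (C ℝ n).eval (2 * x) = 2 * (T ℝ n).eval x := by
    simpa using congrArg (Polynomial.eval x) (C_comp_two_mul_X ℝ n)
  rw [arcsineLaw, integral_smul_measure, integral_map (by fun_prop) (by fun_prop),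
    ENNReal.toReal_ofReal (by positivity)]
  simp only [hC, integral_const_mul]
  split_ifs with hn
  · rw [hn, integral_eval_T_real_measureT_zero, smul_eq_mul]
    field_simp
  · rw [integral_eval_T_real_measureT_of_ne_zero hn, mul_zero, smul_zero]

end ArcsineLaw

section SpectralMeasureProperties

variable {E : Type*} [NormedAddCommGroup E] [InnerProductSpace ℂ E] [CompleteSpace E]
  {T : E →L[ℂ] E} (hT : IsSelfAdjoint T)

instance regular_spectralMeasure (ψ : E) : (spectralMeasure T hT ψ).Regular :=
  RealRMK.regular_rieszMeasure _

theorem ae_spectralMeasure_mem_spectrum (ψ : E) :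
    ∀ᵐ x ∂(spectralMeasure T hT ψ), x ∈ spectrum ℝ T := by
  have hopen : IsOpen (spectrum ℝ T)ᶜ := (spectrum.isClosed T).isOpen_compl
  rw [ae_iff, ← Set.compl_def, hopen.measure_eq_iSup_isCompact, ← nonpos_iff_eq_zero]
  refine iSup₂_le fun K hKs => iSup_le fun hK => ?_
  obtain ⟨f, hf_one, hf_supp, hf_sub, hf_mem⟩ :=
    exists_continuousMap_one_of_isCompact_subset_isOpen hK hopen hKs
  let g : C_c(ℝ, ℝ) := ⟨f, hasCompactSupport_def.mpr hf_supp⟩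
  have hg : cfc (g : ℝ → ℝ) T = 0 := by
    rw [← cfc_const_zero ℝ T]
    exact cfc_congr fun x hx => image_eq_zero_of_notMem_tsupport fun hx' => hf_sub hx' hx
  calc spectralMeasure T hT ψ K
      ≤ ENNReal.ofReal (spectralFunctional T hT ψ g) :=
        RealRMK.rieszMeasure_le_of_eq_one _ (fun x => (hf_mem x).1) hK hf_one
    _ = ENNReal.ofReal (inner ℂ ψ (cfc (g : ℝ → ℝ) T ψ)).re := rfl
    _ = 0 := by simp [hg]

instance isFiniteMeasure_spectralMeasure (ψ : E) : IsFiniteMeasure (spectralMeasure T hT ψ) where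
  measure_univ_lt_top := by
    rw [← measure_congr (Filter.eventuallyEq_univ.2 (ae_spectralMeasure_mem_spectrum hT ψ))]
    exact (spectrum.isCompact T).measure_lt_top

theorem integrable_spectralMeasure (ψ : E) {f : ℝ → ℝ} (hf : Continuous f) :
    Integrable f (spectralMeasure T hT ψ) :=
  integrable_of_ae_mem_isCompact (spectrum.isCompact T) (ae_spectralMeasure_mem_spectrum hT ψ) hf

theorem integral_spectralMeasure_of_continuous (ψ : E) {f : ℝ → ℝ} (hf : Continuous f) :
    ∫ x, f x ∂(spectralMeasure T hT ψ) = (inner ℂ ψ (cfc f T ψ)).re := by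
  obtain ⟨χ, hχ_one, hχ_supp, -, -⟩ := exists_continuousMap_one_of_isCompact_subset_isOpen
    (spectrum.isCompact (𝕜 := ℝ) T) isOpen_univ (Set.subset_univ _)
  let g : C_c(ℝ, ℝ) := ⟨χ * ⟨f, hf⟩, (hasCompactSupport_def.mpr hχ_supp).mul_right⟩
  have hfg : Set.EqOn f g (spectrum ℝ T) := fun x hx => by simp [g, hχ_one hx]
  rw [integral_congr_ae ((ae_spectralMeasure_mem_spectrum hT ψ).mono hfg),
    integral_spectralMeasure, cfc_congr hfg]

theorem integral_pow_spectralMeasure (ψ : E) (k : ℕ) :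
    ∫ x, x ^ k ∂(spectralMeasure T hT ψ) = (inner ℂ ψ ((T ^ k) ψ)).re := by
  rw [integral_spectralMeasure_of_continuous hT ψ (continuous_pow k), cfc_pow_id T k]

theorem spectralMeasure_real_univ (ψ : E) :
    (spectralMeasure T hT ψ).real Set.univ = ‖ψ‖ ^ 2 := by
  have h := integral_pow_spectralMeasure hT ψ 0
  simpa [inner_self_eq_norm_sq_to_K, ← Complex.ofReal_pow] using h

theorem spectralMeasure_eq_of_moments {ψ : E} {ν : Measure ℝ} [IsFiniteMeasure ν] {K : Set ℝ}
    (hK : IsCompact K) (hν : ∀ᵐ x ∂ν, x ∈ K)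
    (h : ∀ k : ℕ, (inner ℂ ψ ((T ^ k) ψ)).re = ∫ x, x ^ k ∂ν) : spectralMeasure T hT ψ = ν :=
  measure_ext_of_moments (spectrum.isCompact T) hK (ae_spectralMeasure_mem_spectrum hT ψ) hν
    fun k => (integral_pow_spectralMeasure hT ψ k).trans (h k)

theorem spectralMeasure_smul (c : ℂ) (ψ : E) :
    spectralMeasure T hT (c • ψ) = ‖c‖₊ ^ 2 • spectralMeasure T hT ψ := by
  refine Measure.ext_of_integral_eq_on_compactlySupported fun f => ?_
  rw [integral_smul_nnreal_measure]
  simp only [integral_spectralMeasure, map_smul, inner_smul_left, inner_smul_right, ← mul_assoc,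
    Complex.mul_conj', NNReal.smul_def, NNReal.coe_pow, coe_nnnorm, smul_eq_mul]
  rw [← Complex.ofReal_pow, Complex.re_ofReal_mul]

theorem spectralMeasure_zero : spectralMeasure T hT 0 = 0 := by
  simpa using spectralMeasure_smul hT 0 (0 : E)

theorem spectralMeasure_parallelogram (φ ψ : E) :
    spectralMeasure T hT (φ + ψ) + spectralMeasure T hT (φ - ψ) =
      (2 : NNReal) • (spectralMeasure T hT φ + spectralMeasure T hT ψ) := by
  refine Measure.ext_of_integral_eq_on_compactlySupported fun f => ?_
  rw [integral_add_measure f.integrable f.integrable, integral_smul_nnreal_measure,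
    integral_add_measure f.integrable f.integrable]
  simp only [integral_spectralMeasure, map_add, map_sub, inner_add_left, inner_add_right,
    inner_sub_left, inner_sub_right, Complex.add_re, Complex.sub_re, NNReal.smul_def,
    NNReal.coe_ofNat, smul_eq_mul]
  ring

theorem spectralMeasure_add_le (φ ψ : E) :
    spectralMeasure T hT (φ + ψ) ≤
      (2 : NNReal) • (spectralMeasure T hT φ + spectralMeasure T hT ψ) :=
  spectralMeasure_parallelogram hT φ ψ ▸ Measure.le_add_right le_rfl

/-- The absolutely continuous subspace of a bounded self-adjoint operator: the vectors whose
spectral measure is absolutely continuous with respect to Lebesgue measure. -/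
def acSubspace : Submodule ℂ E where
  carrier := {ψ | spectralMeasure T hT ψ ≪ volume}
  zero_mem' := by simp [spectralMeasure_zero, Measure.AbsolutelyContinuous.zero]
  add_mem' {φ ψ} hφ hψ := (spectralMeasure_add_le hT φ ψ).absolutelyContinuous.trans
    (Measure.smul_absolutelyContinuous.trans (Measure.AbsolutelyContinuous.add_left hφ hψ))
  smul_mem' c ψ hψ := by
    rw [Set.mem_ofPred_eq, spectralMeasure_smul]
    exact Measure.smul_absolutelyContinuous.trans hψ

theorem mem_acSubspace {ψ : E} : ψ ∈ acSubspace hT ↔ spectralMeasure T hT ψ ≪ volume :=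
  Iff.rfl

theorem isClosed_acSubspace : IsClosed (acSubspace hT : Set E) := by
  refine isClosed_of_closure_subset fun φ hφ s hs => ?_
  rw [← measureReal_eq_zero_iff]
  refine le_antisymm (le_of_forall_pos_le_add fun ε hε => ?_) measureReal_nonneg
  obtain ⟨ψ, hψ, hd⟩ := Metric.mem_closure_iff.1 hφ (√(ε / 2)) (by positivity)
  rw [dist_eq_norm] at hd
  have hψs : (spectralMeasure T hT ψ).real s = 0 := by simp [measureReal_def, hψ hs]
  have hsmall : (spectralMeasure T hT (φ - ψ)).real s ≤ ε / 2 :=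
    calc (spectralMeasure T hT (φ - ψ)).real s
        ≤ (spectralMeasure T hT (φ - ψ)).real Set.univ := measureReal_mono (Set.subset_univ s)
      _ = ‖φ - ψ‖ ^ 2 := spectralMeasure_real_univ hT _
      _ ≤ ε / 2 := (Real.le_sqrt (norm_nonneg _) (by positivity)).1 hd.le
  calc (spectralMeasure T hT φ).real s
      = (spectralMeasure T hT (ψ + (φ - ψ))).real s := by rw [add_sub_cancel]
    _ ≤ ((2 : NNReal) • (spectralMeasure T hT ψ + spectralMeasure T hT (φ - ψ))).real s :=
        ENNReal.toReal_mono (by finiteness) (spectralMeasure_add_le hT _ _ s)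
    _ = 2 * (spectralMeasure T hT (φ - ψ)).real s := by
        rw [measureReal_nnreal_smul_apply, measureReal_add_apply, hψs, zero_add, NNReal.coe_ofNat]
    _ ≤ 0 + ε := by linarith

end SpectralMeasureProperties

section ConvolutionWithArcsineLaw

variable {E : Type*} [NormedAddCommGroup E] [InnerProductSpace ℂ E] [CompleteSpace E]

theorem spectralMeasure_add_eq_conv {K D : E →L[ℂ] E} (hK : IsSelfAdjoint K)
    (hKD : IsSelfAdjoint (K + D)) (hcomm : Commute K D) {ν : Measure ℝ} [IsFiniteMeasure ν]
    {L : Set ℝ} (hL : IsCompact L) (hν : ∀ᵐ x ∂ν, x ∈ L) {ψ : E}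
    (h : ∀ a b : ℕ, (inner ℂ ψ ((K ^ a * D ^ b) ψ)).re =
      (inner ℂ ψ ((K ^ a) ψ)).re * ∫ x, x ^ b ∂ν) :
    spectralMeasure (K + D) hKD ψ = (spectralMeasure K hK ψ).conv ν := by
  have hKL : IsCompact (spectrum ℝ K + L) := (spectrum.isCompact K).add hL
  refine spectralMeasure_eq_of_moments hKD hKL
    (ae_conv_mem_add hKL.measurableSet (ae_spectralMeasure_mem_spectrum hK ψ) hν) fun k => ?_
  rw [integral_pow_conv (fun m => integrable_spectralMeasure hK ψ (continuous_pow m))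
    (fun m => integrable_of_ae_mem_isCompact hL hν (continuous_pow m)), hcomm.add_pow,
    sum_apply, inner_sum, Complex.re_sum]
  refine Finset.sum_congr rfl fun m _ => ?_
  rw [integral_pow_spectralMeasure, ← h, ← nsmul_eq_mul', smul_apply, ← Nat.cast_smul_eq_nsmul ℂ,
    inner_smul_right, ← Complex.ofReal_natCast, Complex.re_ofReal_mul, mul_comm]

theorem inner_aeval_add_star {U : E →L[ℂ] E} (hU : U ∈ unitary (E →L[ℂ] E)) {φ ψ : E}
    (hφ : ∀ n ≠ 0, inner ℂ φ ((U ^ n) ψ) = 0) (hψ : ∀ n ≠ 0, inner ℂ ((U ^ n) φ) ψ = 0)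
    (p : ℝ[X]) :
    inner ℂ φ (Polynomial.aeval (U + star U) p ψ) =
      ((∫ x, p.eval x ∂arcsineLaw : ℝ) : ℂ) * inner ℂ φ ψ := by
  have hp : p ∈ Submodule.span ℝ (Set.range fun n : ℕ => C ℝ n) := by
    simp [span_range_chebyshev_C_eq_top]
  induction hp using Submodule.span_induction with
  | mem p hp =>
    obtain ⟨n, rfl⟩ := hp
    simp only
    rw [aeval_add_chebyshev_C_of_mul_eq_one (Unitary.mul_star_self_of_mem hU)
      (Unitary.star_mul_self_of_mem hU), integral_chebyshev_C_arcsineLaw, ← star_pow, add_apply,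
      inner_add_right, ContinuousLinearMap.star_eq_adjoint,
      ContinuousLinearMap.adjoint_inner_right]
    rcases eq_or_ne n 0 with rfl | hn
    · simp [two_mul]
    · rw [hφ n hn, hψ n hn, if_neg (mod_cast hn), Complex.ofReal_zero, zero_mul, add_zero]
  | zero => simp
  | add p q _ _ hp hq =>
    simp only [map_add, add_apply, inner_add_right, hp, hq, Polynomial.eval_add]
    rw [integral_add (integrable_arcsineLaw p.continuous) (integrable_arcsineLaw q.continuous),
      Complex.ofReal_add, add_mul]
  | smul r p _ hp =>
    simp only [map_smul, smul_apply, Polynomial.eval_smul, smul_eq_mul, ← Complex.coe_smul,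
      inner_smul_right, hp]
    rw [integral_const_mul, Complex.ofReal_mul, mul_assoc]

theorem spectralMeasure_add_unitary_add_star {K U : E →L[ℂ] E} (hK : IsSelfAdjoint K)
    (hU : U ∈ unitary (E →L[ℂ] E)) (hKU : Commute K U) (hH : IsSelfAdjoint (K + (U + star U)))
    {ψ : E} (hψ : ∀ n ≠ 0, ∀ a : ℕ, inner ℂ ψ ((K ^ a) ((U ^ n) ψ)) = 0) :
    spectralMeasure (K + (U + star U)) hH ψ = (spectralMeasure K hK ψ).conv arcsineLaw := by
  have hKU' : Commute K (star U) := by simpa [hK.star_eq] using hKU.star_star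
  have hsymm (a : ℕ) (χ : E) : inner ℂ ((K ^ a) ψ) χ = inner ℂ ψ ((K ^ a) χ) :=
    ContinuousLinearMap.isSelfAdjoint_iff_isSymmetric.1 (hK.pow a) ψ χ
  refine spectralMeasure_add_eq_conv hK hH (hKU.add_right hKU') isCompact_Icc
    ae_arcsineLaw_mem_Icc fun a b => ?_
  have h := inner_aeval_add_star hU (φ := (K ^ a) ψ) (ψ := ψ)
    (fun n hn => by rw [hsymm, hψ n hn])
    (fun n hn => by
      rw [← inner_conj_symm, ← mul_apply_eq_comp, ← (hKU.pow_pow a n).eq, mul_apply_eq_comp,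
        hψ n hn, map_zero])
    (Polynomial.X ^ b)
  simp only [map_pow, Polynomial.aeval_X, Polynomial.eval_pow, Polynomial.eval_X] at h
  rw [mul_apply_eq_comp, ← hsymm, h, Complex.re_ofReal_mul, hsymm, mul_comm]

theorem mem_acSubspace_add_unitary_add_star {K U : E →L[ℂ] E} (hK : IsSelfAdjoint K)
    (hU : U ∈ unitary (E →L[ℂ] E)) (hKU : Commute K U) (hH : IsSelfAdjoint (K + (U + star U)))
    {ψ : E} (hψ : ∀ n ≠ 0, ∀ a : ℕ, inner ℂ ψ ((K ^ a) ((U ^ n) ψ)) = 0) :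
    ψ ∈ acSubspace hH := by
  rw [mem_acSubspace, spectralMeasure_add_unitary_add_star hK hU hKU hH hψ]
  exact Measure.conv_absolutelyContinuous arcsineLaw_absolutelyContinuous

end ConvolutionWithArcsineLaw

section Translation

variable {G : Type*} [AddGroup G]

/-- Translation by `a` on `ℓ²(G)`, with the sign convention `(S_a ψ)(g) = ψ(g + a)`. -/
noncomputable def translation (a : G) : ℓ²(G, ℂ) →L[ℂ] ℓ²(G, ℂ) :=
  LinearMap.mkContinuous
    { toFun := fun ψ => ⟨fun g => ψ (g + a), memℓp_two_comp_equiv (Equiv.addRight a) ψ.2⟩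
      map_add' := fun _ _ => rfl
      map_smul' := fun _ _ => rfl } 1 fun ψ => by
    have h2 : 0 < (2 : ℝ≥0∞).toReal := by norm_num
    rw [one_mul, lp.norm_eq_tsum_rpow h2, lp.norm_eq_tsum_rpow h2]
    exact (congrArg (· ^ (1 / (2 : ℝ≥0∞).toReal))
      ((Equiv.addRight a).tsum_eq fun g => ‖ψ g‖ ^ (2 : ℝ≥0∞).toReal)).le

theorem translation_apply (a : G) (ψ : ℓ²(G, ℂ)) (g : G) : translation a ψ g = ψ (g + a) := rfl

theorem translation_zero : translation (0 : G) = 1 := by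
  ext ψ g
  simp [translation_apply]

theorem translation_mul (a b : G) : translation a * translation b = translation (a + b) := by
  ext ψ g
  simp [translation_apply, add_assoc]

theorem star_translation (a : G) : star (translation a) = translation (-a) := by
  refine ((ContinuousLinearMap.eq_adjoint_iff _ _).2 fun φ ψ => ?_).symm
  rw [lp.inner_eq_tsum, lp.inner_eq_tsum,
    ← (Equiv.addRight a).tsum_eq fun g => inner ℂ (translation (-a) φ g) (ψ g)]
  simp [translation_apply]

theorem translation_mem_unitary (a : G) : translation a ∈ unitary (ℓ²(G, ℂ) →L[ℂ] ℓ²(G, ℂ)) := by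
  rw [Unitary.mem_iff, star_translation, translation_mul, translation_mul, neg_add_cancel,
    add_neg_cancel, translation_zero]
  exact ⟨rfl, rfl⟩

end Translation

section Lattice

variable (V : lp (fun _ : ℤ => ℝ) ∞)

/-- The multiplication operator `ψ ↦ V ψ` on `ℓ²(ℤ²)`, where `(V ψ)(n, m) = V(n) ψ(n, m)`. -/
noncomputable def potentialOp : ℓ²(ℤ × ℤ, ℂ) →L[ℂ] ℓ²(ℤ × ℤ, ℂ) :=
  lp.mapCLM 2 (fun p => (V p.1 : ℂ) • ContinuousLinearMap.id ℂ ℂ) (norm_nonneg V) fun p => by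
    simpa [norm_smul] using lp.norm_apply_le_norm ENNReal.top_ne_zero V p.1

theorem potentialOp_apply (ψ : ℓ²(ℤ × ℤ, ℂ)) (p : ℤ × ℤ) : potentialOp V ψ p = V p.1 * ψ p := rfl

theorem isSelfAdjoint_potentialOp : IsSelfAdjoint (potentialOp V) := by
  refine ContinuousLinearMap.isSelfAdjoint_iff_isSymmetric.2 fun φ ψ => ?_
  simp only [ContinuousLinearMap.coe_coe, lp.inner_eq_tsum, potentialOp_apply]
  refine tsum_congr fun p => ?_
  simp only [RCLike.inner_apply, map_mul, Complex.conj_ofReal]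
  ring

/-- The part of the Schrödinger operator `-Δ + V` that acts in the first variable only. -/
noncomputable def horizontalOp : ℓ²(ℤ × ℤ, ℂ) →L[ℂ] ℓ²(ℤ × ℤ, ℂ) :=
  potentialOp V - (translation (1, 0) + star (translation (1, 0)))

theorem horizontalOp_apply (ψ : ℓ²(ℤ × ℤ, ℂ)) (p : ℤ × ℤ) :
    horizontalOp V ψ p = V p.1 * ψ p - (ψ (p.1 + 1, p.2) + ψ (p.1 - 1, p.2)) := by
  simp [horizontalOp, potentialOp_apply, star_translation, translation_apply, Prod.add_def,
    sub_eq_add_neg]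

theorem isSelfAdjoint_horizontalOp : IsSelfAdjoint (horizontalOp V) :=
  (isSelfAdjoint_potentialOp V).sub (IsSelfAdjoint.add_star_self _)

theorem horizontalOp_pow_apply_eq_zero {ψ : ℓ²(ℤ × ℤ, ℂ)} {m : ℤ} (hψ : ∀ n, ψ (n, m) = 0)
    (a : ℕ) (n : ℤ) : (horizontalOp V ^ a) ψ (n, m) = 0 := by
  induction a generalizing n with
  | zero => exact hψ n
  | succ a ih =>
    rw [pow_succ', mul_apply_eq_comp, horizontalOp_apply]
    simp only [ih, mul_zero, add_zero, sub_zero]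

/-- Minus the unit translation in the second variable, the direction in which the potential is
constant; the sign is chosen so that `-Δ + V = horizontalOp V + (verticalOp + star verticalOp)`. -/
noncomputable def verticalOp : ℓ²(ℤ × ℤ, ℂ) →L[ℂ] ℓ²(ℤ × ℤ, ℂ) :=
  -translation (0, 1)

theorem verticalOp_mem_unitary : verticalOp ∈ unitary (ℓ²(ℤ × ℤ, ℂ) →L[ℂ] ℓ²(ℤ × ℤ, ℂ)) :=
  (-(⟨translation (0, 1), translation_mem_unitary _⟩ : unitary _)).2

theorem verticalOp_apply (ψ : ℓ²(ℤ × ℤ, ℂ)) (p : ℤ × ℤ) :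
    verticalOp ψ p = -ψ (p.1, p.2 + 1) := by
  simp [verticalOp, translation_apply, Prod.add_def]

theorem verticalOp_pow_apply (k : ℕ) (ψ : ℓ²(ℤ × ℤ, ℂ)) (p : ℤ × ℤ) :
    (verticalOp ^ k) ψ p = (-1) ^ k * ψ (p.1, p.2 + k) := by
  induction k generalizing p with
  | zero => simp
  | succ k ih =>
    rw [pow_succ', mul_apply_eq_comp, verticalOp_apply, ih]
    push_cast
    ring_nf

theorem commute_horizontalOp_verticalOp : Commute (horizontalOp V) verticalOp := by
  refine Commute.neg_right ?_
  ext ψ p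
  simp [translation_apply, horizontalOp_apply, Prod.add_def]

theorem schrodinger_eq_horizontalOp_add :
    schrodinger V = horizontalOp V + (verticalOp + star verticalOp) := by
  ext ψ p
  change schrodingerLinear V ψ p = _
  simp only [schrodingerLinear_apply, verticalOp, star_neg, star_translation, add_apply,
    neg_apply, lp.coeFn_add, lp.coeFn_neg, Pi.add_apply, Pi.neg_apply, horizontalOp_apply,
    translation_apply, Prod.add_def, Prod.neg_mk, neg_zero, add_zero, sub_eq_add_neg]
  ring

theorem isSelfAdjoint_schrodinger : IsSelfAdjoint (schrodinger V) := by
  rw [schrodinger_eq_horizontalOp_add]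
  exact (isSelfAdjoint_horizontalOp V).add (IsSelfAdjoint.add_star_self _)

theorem single_mem_acSubspace (p : ℤ × ℤ) (c : ℂ) :
    lp.single 2 p c ∈ acSubspace (isSelfAdjoint_schrodinger V) := by
  have hsum := isSelfAdjoint_schrodinger V
  rw [schrodinger_eq_horizontalOp_add] at hsum
  suffices h : lp.single 2 p c ∈ acSubspace hsum by
    simpa only [schrodinger_eq_horizontalOp_add] using h
  refine mem_acSubspace_add_unitary_add_star (isSelfAdjoint_horizontalOp V)
    verticalOp_mem_unitary (commute_horizontalOp_verticalOp V) hsum fun k hk a => ?_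
  have hrow (n : ℤ) : (verticalOp ^ k) (lp.single 2 p c) (n, p.2) = 0 := by
    rw [verticalOp_pow_apply, lp.single_apply_ne, mul_zero]
    simp [Prod.ext_iff, hk]
  rw [lp.inner_single_left, horizontalOp_pow_apply_eq_zero V hrow, inner_zero_right]

end Lattice

theorem theorem1 (V : lp (fun _ : ℤ => ℝ) ∞) : HasPurelyACSpectrum (schrodinger V) := by
  refine ⟨isSelfAdjoint_schrodinger V, fun ψ => ?_⟩
  have hsum : HasSum (fun p => lp.single 2 p (ψ p)) ψ := lp.hasSum_single (by simp) ψ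
  exact (isClosed_acSubspace (isSelfAdjoint_schrodinger V)).mem_of_tendsto hsum
    (.of_forall fun s => sum_mem fun p _ => single_mem_acSubspace V p (ψ p))
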